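/- Let $I$ be a finite set and let $(W,S)$, $S=\{s_i : i\in I\}$, be a Coxeter system with $m(i,i)=1$ and $m(i,j)=m(j,i)\in\{2,3,\dots\}\cup\{\infty\}$ for $i\neq j$. Let $V=\mathbb{R}^I$ with standard basis $(\alpha_i)_{i\in I}$, and let $B$ be the symmetric bilinear form on $V$ with $B(\alpha_i,\alpha_j)=-\cos(\pi/m(i,j))$ if $m(i,j)<\infty$ and $B(\alpha_i,\alpha_j)=-1$ otherwise. Let $W$ act on $V$ by $s_i\beta=\beta-2B(\beta,\alpha_i)\alpha_i$. Let $\Phi=\{w\alpha_i : w\in W,\ i\in I\}$, and let $\Phi^+$ be the set of roots $\beta\in\Phi$ that are nonnegative linear combinations of the $\alpha_i$. For $\beta\in\Phi$ let $H_\beta^+=\{w\in W : w\beta\in\Phi^+\}$. For a nonempty set $\mathscr{L}\subseteq W$ let $\mathrm{R}(\mathscr{L})=\{\beta\in\Phi : \mathscr{L}\subseteq H_\beta^+\}$. Call $\mathscr{L}$ convex if $\mathscr{L}=\bigcap_{\beta\in \mathrm{R}(\mathscr{L})}H_\beta^+$ (an empty intersection is $W$). Given a nonempty convex set $\mathscr{L}$,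 define for each $i\in I$ the noninvertible Bender--Knuth toggle $\tau_i\colon W\to W$ by \[ \tau_i(u)=\begin{cases} u & \text{if } u^{-1}\alpha_i\in \mathrm{R}(\mathscr{L}),\\ s_iu & \text{if } u^{-1}\alpha_i\notin \mathrm{R}(\mathscr{L}).\end{cases} \] For a Coxeter element $c=s_{i_n}\cdots s_{i_1}$, where $i_1,\dots,i_n$ is an ordering of $I$ in which each element appears exactly once, let $\mathrm{Pro}_c=\tau_{i_n}\circ\cdots\circ\tau_{i_1}$ (this depends only on $c$ and $\mathscr{L}$, not on the ordering that represents $c$). The Coxeter group $W$ is called superfuturistic if for every Coxeter element $c$, every nonempty convex set $\mathscr{L}\subseteq W$ and every $u\in W$, there is an integer $K\ge 0$ such that $\mathrm{Pro}_c^K(u)\in\mathscr{L}$. Theorem. Every finite Coxeter group is superfuturistic. -/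

import Mathlib

noncomputable section

namespace BenderKnuth

section RootSpace

variable {I : Type*} [Fintype I] [DecidableEq I] (M : CoxeterMatrix I)

/-- The simple root `α i`, a standard basis vector of the root space `V = ℝ^I`. -/
def simpleRoot (i : I) : I → ℝ := Pi.single i 1

/-- The Gram matrix of the simple roots. Mathlib encodes `m(i, j) = ∞` as `M i j = 0`. -/
def gram : Matrix I I ℝ := Matrix.of fun i j =>
  if M i j = 0 then -1 else -Real.cos (Real.pi / (M i j : ℝ))

/-- The symmetric bilinear form on the root space induced by the Coxeter matrix. -/
def form : LinearMap.BilinForm ℝ (I → ℝ) := Matrix.toBilin' (gram M)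

/-- The linear form `β ↦ 2 B(β, α i)`. -/
def coroot (i : I) : Module.Dual ℝ (I → ℝ) := (2 : ℝ) • (form M).flip (simpleRoot i)

theorem coroot_apply (i : I) (β : I → ℝ) :
    coroot M i β = 2 * form M β (simpleRoot i) := by
  simp [coroot]

theorem form_simpleRoot (i j : I) : form M (simpleRoot i) (simpleRoot j) = gram M i j := by
  simp [form, simpleRoot]

theorem coroot_self (i : I) : coroot M i (simpleRoot i) = 2 := by
  rw [coroot_apply, form_simpleRoot]
  simp [gram]

/-- The reflection `β ↦ β - 2 B(β, α i) α i` of the root space. -/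
def simpleRefl (i : I) : (I → ℝ) →ₗ[ℝ] (I → ℝ) :=
  (Module.reflection (coroot_self M i)).toLinearMap

theorem simpleRefl_apply (i : I) (β : I → ℝ) :
    simpleRefl M i β = β - (2 * form M β (simpleRoot i)) • simpleRoot i := by
  simp [simpleRefl, Module.reflection_apply, coroot_apply]

/-- The reflections satisfy the Coxeter relations. -/
theorem simpleRefl_isLiftable : M.IsLiftable (simpleRefl M) := by
  intro i j
  have key : (Module.reflection (coroot_self M i) * Module.reflection (coroot_self M j)) ^ M i j
      = 1 := by
    by_cases hij : i = j
    · subst hij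
      rw [M.diagonal, pow_one]
      ext1 z
      exact Module.involutive_reflection _ z
    by_cases h0 : M i j = 0
    · rw [h0, pow_zero]
    have h1 : M i j ≠ 1 := M.off_diagonal i j hij
    have hfy : coroot M i (simpleRoot j) = -(2 * Real.cos (Real.pi / (M i j : ℝ))) := by
      rw [coroot_apply, form_simpleRoot]
      simp [gram, M.symmetric j i, h0]
    have hgx : coroot M j (simpleRoot i) = -(2 * Real.cos (Real.pi / (M i j : ℝ))) := by
      rw [coroot_apply, form_simpleRoot]
      simp [gram, h0]
    by_cases h2 : M i j = 2
    · rw [h2] at hfy hgx ⊢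
      have hc : Real.cos (Real.pi / ((2 : ℕ) : ℝ)) = 0 := by
        simp
      rw [hc] at hfy hgx
      ext1 z
      simp only [pow_two, LinearEquiv.mul_apply, LinearEquiv.coe_one, id, Module.reflection_apply,
        map_sub, map_smul, hfy, hgx, coroot_self]
      module
    have h3 : 3 ≤ M i j := by omega
    have hpos : (0 : ℝ) < M i j := by positivity
    have h3' : (3 : ℝ) ≤ M i j := by exact_mod_cast h3
    set θ : ℝ := 2 * Real.pi / (M i j : ℝ) with hθ
    have hsin : Real.sin θ ≠ 0 := by
      apply ne_of_gt
      apply Real.sin_pos_of_pos_of_lt_pi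
      · positivity
      · rw [hθ, div_lt_iff₀ hpos]
        nlinarith [Real.pi_pos]
    have ht : 2 * Real.cos θ = coroot M i (simpleRoot j) * coroot M j (simpleRoot i) - 2 := by
      rw [hfy, hgx, hθ, mul_div_assoc, Real.cos_two_mul]
      ring
    have hS (n : ℤ) := Polynomial.Chebyshev.S_two_mul_real_cos θ n
    apply LinearEquiv.toLinearMap_injective
    rw [Module.reflection_mul_reflection_pow (coroot_self M i) (coroot_self M j) (M i j) _ ht]
    obtain ⟨k, hk⟩ := Nat.even_or_odd' (M i j)
    rcases hk with hk | hk
    · have e1 : ((M i j : ℤ) - 2) / 2 = k - 1 := by omega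
      have e2 : ((M i j : ℤ) - 1) / 2 = k - 1 := by omega
      have hz : (Polynomial.Chebyshev.S ℝ ((k : ℤ) - 1)).eval (2 * Real.cos θ) = 0 := by
        have h := hS ((k : ℤ) - 1)
        have : (((((k : ℤ) - 1 : ℤ) : ℝ) + 1) * θ) = Real.pi := by
          have : (M i j : ℝ) = 2 * k := by exact_mod_cast hk
          rw [hθ, this]
          rw [this] at hpos
          push_cast
          have : (k : ℝ) ≠ 0 := by intro h; simp [h] at hpos
          field_simp
          ring
        rw [this, Real.sin_pi] at h
        exact (mul_eq_zero.mp h).resolve_right hsin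
      rw [e1, e2, hz]
      simp
    · have e1 : ((M i j : ℤ) - 2) / 2 = k - 1 := by omega
      have e2 : ((M i j : ℤ) - 1) / 2 = k := by omega
      have e3 : ((M i j : ℤ) - 3) / 2 = k - 1 := by omega
      have e4 : (M i j : ℤ) / 2 = k := by omega
      have hz : (Polynomial.Chebyshev.S ℝ (k : ℤ)).eval (2 * Real.cos θ) +
          (Polynomial.Chebyshev.S ℝ ((k : ℤ) - 1)).eval (2 * Real.cos θ) = 0 := by
        have ha := hS (k : ℤ)
        have hb := hS ((k : ℤ) - 1)
        have h5 : (M i j : ℝ) = 2 * k + 1 := by exact_mod_cast hk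
        have h6 : (((k : ℤ) : ℝ) + 1) * θ = 2 * Real.pi - (((((k : ℤ) - 1 : ℤ) : ℝ) + 1) * θ) := by
          rw [hθ, h5]
          push_cast
          rw [h5] at hpos
          field_simp
          ring
        rw [h6, Real.sin_two_pi_sub] at ha
        have : ((Polynomial.Chebyshev.S ℝ (k : ℤ)).eval (2 * Real.cos θ) +
          (Polynomial.Chebyshev.S ℝ ((k : ℤ) - 1)).eval (2 * Real.cos θ)) * Real.sin θ = 0 := by
          rw [add_mul, ha, hb]; ring
        exact (mul_eq_zero.mp this).resolve_right hsin
      rw [e1, e2, e3, e4, hz]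
      simp
  have := congrArg (LinearEquiv.toLinearMap) key
  rw [← LinearEquiv.automorphismGroup.toLinearMapMonoidHom_apply, map_pow, map_mul] at this
  exact this

end RootSpace

section Group

variable {I : Type*} [Fintype I] [DecidableEq I] {M : CoxeterMatrix I}
  {W : Type*} [Group W] (cs : CoxeterSystem M W)

/-- The standard geometric representation `ρ` of the Coxeter group on the root space, determined by
`ρ (s i) β = β - 2 B(β, α i) α i`. -/
def geomRep : Representation ℝ W (I → ℝ) :=
  cs.lift ⟨simpleRefl M, simpleRefl_isLiftable M⟩

theorem geomRep_simple (i : I) (β : I → ℝ) :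
    geomRep cs (cs.simple i) β = β - (2 * form M β (simpleRoot i)) • simpleRoot i := by
  rw [geomRep, cs.lift_apply_simple, simpleRefl_apply]

/-- The root system `Φ = {w α i}`. -/
def roots : Set (I → ℝ) := {β | ∃ (w : W) (i : I), β = geomRep cs w (simpleRoot i)}

/-- The positive roots: the roots that are nonnegative combinations of the simple roots. -/
def posRoots : Set (I → ℝ) := {β | β ∈ roots cs ∧ ∀ i, 0 ≤ β i}

/-- The half-space `H_β⁺ = {w ∈ W : w β ∈ Φ⁺}`. -/
def halfSpace (β : I → ℝ) : Set W := {w | geomRep cs w β ∈ posRoots cs}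

/-- `R(L)`, the set of roots `β` with `L ⊆ H_β⁺`. -/
def rootsOf (L : Set W) : Set (I → ℝ) := {β | β ∈ roots cs ∧ L ⊆ halfSpace cs β}

/-- The convex hull of `L`: the intersection of all the half-spaces that contain `L`. -/
def hull (L : Set W) : Set W := ⋂ β ∈ rootsOf cs L, halfSpace cs β

/-- A set is convex if it equals its own convex hull. -/
def IsConvex (L : Set W) : Prop := L = hull cs L

open Classical in
/-- The noninvertible Bender--Knuth toggle `τ i` with respect to `L`. -/
def toggle (L : Set W) (i : I) (u : W) : W :=
  if geomRep cs u⁻¹ (simpleRoot i) ∈ rootsOf cs L then u else cs.simple i * u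

/-- For a word `[i_M, …, i_1]`, the composition `τ i_M ∘ ⋯ ∘ τ i_1` (so `τ i_1` acts first). -/
def toggleWord (L : Set W) (ω : List I) (u : W) : W := ω.foldr (toggle cs L) u

/-- `ω = [i_n, …, i_1]` contains each index exactly once and represents `c = s_{i_n} ⋯ s_{i_1}`. -/
def IsCoxeterWord (c : W) (ω : List I) : Prop :=
  ω.Nodup ∧ (∀ i, i ∈ ω) ∧ cs.wordProd ω = c

/-- A (standard) Coxeter element: a product of the simple reflections in some order, each of them
used exactly once. -/
def IsCoxeterElement (c : W) : Prop := ∃ ω : List I, IsCoxeterWord cs c ω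

/-- `L` is superheavy with respect to the Coxeter element `c`: for every `u`, some iterate of
`Pro_c` sends `u` into `L`. The operator `Pro_c = τ i_n ∘ ⋯ ∘ τ i_1` does not depend on
the word `[i_n, …, i_1]` that represents `c`; the condition is imposed for every such word. -/
def IsSuperheavy (c : W) (L : Set W) : Prop :=
  ∀ ω : List I, IsCoxeterWord cs c ω → ∀ u : W, ∃ K : ℕ, (toggleWord cs L ω)^[K] u ∈ L

/-- A Coxeter element is superfuturistic if every nonempty convex set is superheavy for it. -/
def IsSuperfuturisticElement (c : W) : Prop :=
  ∀ L : Set W, L.Nonempty → IsConvex cs L → IsSuperheavy cs c L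

/-- The Coxeter group is superfuturistic if all of its Coxeter elements are. -/
def IsSuperfuturistic : Prop :=
  ∀ c : W, IsCoxeterElement cs c → IsSuperfuturisticElement cs c

end Group

end BenderKnuth

end

/-!
The orbit of `u` under the toggles can never cross a wall of `L` in the wrong direction, so the set
of separating roots, the `β ∈ R(L)` with `u β` negative, only shrinks. It has to be shown that it is
empty after finitely many rounds.

Let the letters be used cyclically, with `x t` the letter at time `t`. The order in which the letters
are next due orients the Coxeter graph, and gives an Euler form `E t` with `E t + (E t)ᵀ = 2 B` for
which the letter due is a source; consequently `E t (v, α (x t))` is the coordinate of `v` at `x t`,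
and reflecting both arguments in `α (x t)` turns `E t` into `E (t + 1)` (`eulerForm_succ_geomRep`).
Let `η` be a vector that is reflected at each time `t` in `α (x t)`, whatever the toggles do. As long
as `η` is a negative root after each of these reflections, the condition that `E t (u β, η) ≤ 0` for
all separating roots `β` is preserved (`eulerForm_toggle_nonpos`). This holds also when the toggle
does not move `u`, since then `u⁻¹ α (x t)` lies in `R(L)`, which is closed under nonnegative
combinations that are roots.

A Coxeter element of a finite Coxeter group has no nonzero fixed vector. So for each large enough `T`
there is such an `η` that starts as the simple root `α (x t)` due at some time `t` and ends as
`-α (x T)` at time `T`, being negative in between (`exists_root_orbit`). At time `t` the condition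
says that a coordinate of `u β ≤ 0` is nonpositive, which is true; at time `T` it says that the
coordinate of `u β` at `x T` is nonnegative, so it vanishes. A coordinate changes only when its letter
is used, so if `β` still separated after a further round, `u β` would be `0`
(`toggleSeq_mem_hull`).

All this needs that every root is either nonnegative or nonpositive. That is proved for an arbitrary
Coxeter group of finite rank, by induction on length, from the case of rank two
(`geomRep_simpleRoot_nonneg`).
-/

noncomputable section

namespace BenderKnuth

/-! ### The Gram matrix and rank two parabolic subgroups -/

theorem gram_symm {I : Type*} (M : CoxeterMatrix I) (i j : I) : gram M i j = gram M j i := by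
  simp [gram, M.symmetric i j]

theorem gram_self {I : Type*} (M : CoxeterMatrix I) (i : I) : gram M i i = 1 := by
  simp [gram]

theorem simpleRoot_nonneg {I : Type*} [DecidableEq I] (i : I) : 0 ≤ simpleRoot i :=
  Pi.single_nonneg.mpr zero_le_one

/-- The solution of `a (k + 2) = -2 B(α i, α j) a (k + 1) - a k` with `a 0 = 0` and `a 1 = 1` gives
the coordinates of the roots of a rank two subsystem: it is `sin (k π / m) / sin (π / m)`, or `k`
when `m(i, j) = ∞`, and so it is nonnegative up to `k = m(i, j)`. -/
theorem exists_dihedral_coeff {I : Type*} (M : CoxeterMatrix I) {i j : I} (hij : i ≠ j) :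
    ∃ a : ℕ → ℝ, a 0 = 0 ∧ a 1 = 1 ∧ (∀ k, a (k + 2) = -(2 * gram M i j) * a (k + 1) - a k) ∧
      ∀ k, (M i j = 0 ∨ k ≤ M i j) → 0 ≤ a k := by
  by_cases h0 : M i j = 0
  · refine ⟨fun k => k, by simp, by simp, fun k => ?_, fun k _ => by positivity⟩
    simp only [gram, Matrix.of_apply, h0, if_true]
    push_cast
    ring
  · have h1 : M i j ≠ 1 := M.off_diagonal i j hij
    have h2 : (2 : ℝ) ≤ M i j := by exact_mod_cast (by omega : 2 ≤ M i j)
    have hm : (0 : ℝ) < M i j := by linarith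
    set θ : ℝ := Real.pi / (M i j : ℝ) with hθ
    have hsin : 0 < Real.sin θ := by
      apply Real.sin_pos_of_pos_of_lt_pi (by positivity)
      rw [hθ, div_lt_iff₀ hm]
      nlinarith [Real.pi_pos]
    refine ⟨fun k => Real.sin (k * θ) / Real.sin θ, by simp, by simp [hsin.ne'], fun k => ?_,
      fun k hk => ?_⟩
    · have hg : gram M i j = -Real.cos θ := by simp [gram, h0, hθ]
      have e2 : ((k + 2 : ℕ) : ℝ) * θ = ((k : ℝ) + 1) * θ + θ := by push_cast; ring
      have e0 : (k : ℝ) * θ = ((k : ℝ) + 1) * θ - θ := by ring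
      dsimp only
      rw [hg, e2, e0, Real.sin_add, Real.sin_sub]
      push_cast
      field_simp
      ring
    · have hk' : (k : ℝ) ≤ M i j := by exact_mod_cast hk.resolve_left h0
      refine div_nonneg (Real.sin_nonneg_of_nonneg_of_le_pi (by positivity) ?_) hsin.le
      rw [hθ, mul_div_assoc', div_le_iff₀ hm]
      nlinarith [Real.pi_pos]

/-- If `j` is a right descent of `w` and `i` is not, then `w` factors, with lengths adding up, as an
element `v` of minimal length in its coset of the subgroup generated by `s i` and `s j`, times a
nonempty alternating word in `i` and `j` ending with `j`. This word is shorter than the longest one,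
which could also be written so as to end with `i`. -/
theorem exists_alternatingWord_factor {I : Type*} {M : CoxeterMatrix I} {W : Type*} [Group W]
    (cs : CoxeterSystem M W) {w : W} {i j : I}
    (hi : ¬cs.IsRightDescent w i) (hj : cs.IsRightDescent w j) :
    ∃ (v : W) (k : ℕ), w = v * cs.wordProd (CoxeterSystem.alternatingWord i j k) ∧
      cs.length v < cs.length w ∧ (M i j = 0 ∨ k + 1 ≤ M i j) ∧
      ¬cs.IsRightDescent v i ∧ ¬cs.IsRightDescent v j := by
  classical
  let Q : ℕ → Prop := fun k => ∃ v : W,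
    w = v * cs.wordProd (CoxeterSystem.alternatingWord i j k) ∧ cs.length v + k = cs.length w
  have hlen (k : ℕ) : cs.length (cs.wordProd (CoxeterSystem.alternatingWord i j k)) ≤ k := by
    simpa using cs.length_wordProd_le (CoxeterSystem.alternatingWord i j k)
  have hdown : ∀ k, Q (k + 1) → Q k := by
    rintro k ⟨v, hv, hl⟩
    rw [CoxeterSystem.alternatingWord_succ', cs.wordProd_cons, ← mul_assoc] at hv
    refine ⟨_, hv, ?_⟩
    have hw := cs.length_mul_le (v * cs.simple (if Even k then j else i))
      (cs.wordProd (CoxeterSystem.alternatingWord i j k))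
    rw [← hv] at hw
    have := hlen k
    rcases cs.length_mul_simple v (if Even k then j else i) with h | h <;> omega
  have hmono : ∀ k l, k ≤ l → Q l → Q k := fun k l hkl =>
    Nat.le_induction (fun h => h) (fun l _ ih h => ih (hdown l h)) l hkl
  have hQ1 : Q 1 := by
    refine ⟨w * cs.simple j, by simp [CoxeterSystem.alternatingWord], ?_⟩
    exact cs.isRightDescent_iff.mp hj
  obtain ⟨k, hQk, hk1, hmax⟩ : ∃ k, Q k ∧ 1 ≤ k ∧ ¬Q (k + 1) := by
    have hb : ∀ k, Q k → k ≤ cs.length w := fun k ⟨v, _, hl⟩ => by omega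
    refine ⟨Nat.findGreatest Q (cs.length w), Nat.findGreatest_spec (hb 1 hQ1) hQ1,
      Nat.le_findGreatest (hb 1 hQ1) hQ1, fun h => ?_⟩
    have := Nat.le_findGreatest (hb _ h) h
    omega
  obtain ⟨v, hv, hl⟩ := hQk
  -- A descent at the letter that could be put in front contradicts maximality of `k`; a descent at
  -- the first letter of the word contradicts additivity of lengths.
  have hy : ¬cs.IsRightDescent v (if Even k then j else i) := by
    intro h
    refine hmax ⟨v * cs.simple (if Even k then j else i), ?_, ?_⟩
    · rw [CoxeterSystem.alternatingWord_succ', cs.wordProd_cons, ← mul_assoc,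
        cs.simple_mul_simple_cancel_right, ← hv]
    · have := cs.isRightDescent_iff.mp h
      omega
  have hx : ¬cs.IsRightDescent v (if Even k then i else j) := by
    intro h
    obtain ⟨l, rfl⟩ : ∃ l, k = l + 1 := ⟨k - 1, by omega⟩
    have hp : (if Even (l + 1) then i else j) = if Even l then j else i := by
      by_cases hl : Even l <;> simp [hl, Nat.even_add_one]
    rw [hp] at h
    rw [CoxeterSystem.alternatingWord_succ', cs.wordProd_cons, ← mul_assoc] at hv
    have h1 := cs.isRightDescent_iff.mp h
    have h2 := cs.length_mul_le (v * cs.simple (if Even l then j else i))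
      (cs.wordProd (CoxeterSystem.alternatingWord i j l))
    rw [← hv] at h2
    have := hlen l
    omega
  refine ⟨v, k, hv, by omega, ?_, ?_, ?_⟩
  · by_contra! hcon
    obtain ⟨h0, hkm⟩ := hcon
    obtain ⟨l, hl⟩ : ∃ l, M i j = l + 1 := ⟨M i j - 1, by omega⟩
    obtain ⟨v', hv', hl'⟩ := hmono (M i j) k (by omega) ⟨v, hv, ‹_›⟩
    have hbraid := cs.prod_alternatingWord_eq_prod_alternatingWord_sub i j (M i j) (by omega)
    rw [show M i j * 2 - M i j = M i j by omega] at hbraid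
    rw [hbraid, hl, CoxeterSystem.alternatingWord_succ, List.concat_eq_append, cs.wordProd_append,
      cs.wordProd_singleton, ← mul_assoc] at hv'
    apply hi
    rw [CoxeterSystem.IsRightDescent, hv', cs.simple_mul_simple_cancel_right, ← hv']
    have h2 := cs.length_mul_le v' (cs.wordProd (CoxeterSystem.alternatingWord i j l))
    have h3 : cs.length (cs.wordProd (CoxeterSystem.alternatingWord i j l)) ≤ l := by
      simpa using cs.length_wordProd_le (CoxeterSystem.alternatingWord i j l)
    omega
  · by_cases hk : Even k
    · simpa [hk] using hx
    · simpa [hk] using hy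
  · by_cases hk : Even k
    · simpa [hk] using hy
    · simpa [hk] using hx

/-! ### Roots are positive or negative -/

section RootSystem

variable {I : Type*} [Fintype I] [DecidableEq I] {M : CoxeterMatrix I}
  {W : Type*} [Group W] (cs : CoxeterSystem M W)

theorem form_simpleRoot_self (i : I) : form M (simpleRoot i) (simpleRoot i) = 1 := by
  rw [form_simpleRoot, gram_self]

theorem form_comm (v v' : I → ℝ) : form M v v' = form M v' v := by
  simp only [form, Matrix.toBilin'_apply]
  rw [Finset.sum_comm]
  refine Finset.sum_congr rfl fun a _ => Finset.sum_congr rfl fun b _ => ?_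
  rw [gram_symm M b a]
  ring

theorem geomRep_mul_apply (v w : W) (β : I → ℝ) :
    geomRep cs (v * w) β = geomRep cs v (geomRep cs w β) := by
  rw [map_mul, Module.End.mul_apply]

theorem geomRep_simple_simple (i : I) (β : I → ℝ) :
    geomRep cs (cs.simple i) (geomRep cs (cs.simple i) β) = β := by
  rw [← geomRep_mul_apply, cs.simple_mul_simple_self, map_one, Module.End.one_apply]

theorem geomRep_simple_self (i : I) :
    geomRep cs (cs.simple i) (simpleRoot i) = -simpleRoot i := by
  rw [geomRep_simple, form_simpleRoot_self]
  module

theorem geomRep_simple_apply_of_ne {i a : I} (h : a ≠ i) (β : I → ℝ) :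
    geomRep cs (cs.simple i) β a = β a := by
  simp [geomRep_simple, simpleRoot, h]

theorem form_geomRep (w : W) (v v' : I → ℝ) :
    form M (geomRep cs w v) (geomRep cs w v') = form M v v' := by
  induction w using cs.simple_induction_left with
  | one => simp
  | mul_simple_left w i ih =>
    rw [geomRep_mul_apply, geomRep_mul_apply, ← ih, geomRep_simple, geomRep_simple]
    simp only [map_sub, map_smul, LinearMap.sub_apply, LinearMap.smul_apply, smul_eq_mul,
      form_simpleRoot_self, form_comm (simpleRoot i)]
    ring

theorem geomRep_alternatingWord {i j : I} {a : ℕ → ℝ} (h0 : a 0 = 0) (h1 : a 1 = 1)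
    (ha : ∀ k, a (k + 2) = -(2 * gram M i j) * a (k + 1) - a k) (k : ℕ) :
    geomRep cs (cs.wordProd (CoxeterSystem.alternatingWord i j k)) (simpleRoot i) =
      a (k + 1) • simpleRoot (if Even k then i else j) +
        a k • simpleRoot (if Even k then j else i) := by
  induction k with
  | zero => simp [CoxeterSystem.alternatingWord, h0, h1]
  | succ k ih =>
    rw [CoxeterSystem.alternatingWord_succ', cs.wordProd_cons, geomRep_mul_apply, ih, geomRep_simple,
      ha]
    by_cases hk : Even k
    · simp only [hk, if_true, Nat.even_add_one, not_true, if_false, map_add, map_smul,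
        LinearMap.add_apply, LinearMap.smul_apply, form_simpleRoot, gram_self, smul_eq_mul]
      module
    · simp only [hk, if_false, Nat.even_add_one, not_false_iff, if_true, map_add, map_smul,
        LinearMap.add_apply, LinearMap.smul_apply, form_simpleRoot, gram_self, smul_eq_mul,
        gram_symm M j i]
      module

/-- If `ℓ (w s i) > ℓ w`, then `w α i` is nonnegative. With `w` factored by
`exists_alternatingWord_factor`, it is a nonnegative combination of `v α i` and `v α j`, to which
induction on the length applies. -/
theorem geomRep_simpleRoot_nonneg {w : W} {i : I} (hi : ¬cs.IsRightDescent w i) :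
    0 ≤ geomRep cs w (simpleRoot i) := by
  induction hn : cs.length w using Nat.strong_induction_on generalizing w i with
  | _ n ih =>
  by_cases hw : w = 1
  · rw [hw, map_one, Module.End.one_apply]
    exact simpleRoot_nonneg i
  obtain ⟨j, hj⟩ := cs.exists_rightDescent_of_ne_one hw
  have hij : i ≠ j := fun h => hi (h ▸ hj)
  obtain ⟨v, k, hv, hlt, hk, hvi, hvj⟩ := exists_alternatingWord_factor cs hi hj
  obtain ⟨a, h0, h1, ha, hpos⟩ := exists_dihedral_coeff M hij
  rw [hv, geomRep_mul_apply, geomRep_alternatingWord cs h0 h1 ha, map_add, map_smul, map_smul]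
  have hvi' := ih _ (hn ▸ hlt) hvi rfl
  have hvj' := ih _ (hn ▸ hlt) hvj rfl
  refine add_nonneg (smul_nonneg (hpos _ hk) ?_)
    (smul_nonneg (hpos _ (hk.imp_right fun h => by omega)) ?_) <;> split_ifs <;> assumption

theorem simpleRoot_mem_roots (i : I) : simpleRoot i ∈ roots cs := ⟨1, i, by simp⟩

theorem geomRep_mem_roots (w : W) {β : I → ℝ} (hβ : β ∈ roots cs) : geomRep cs w β ∈ roots cs := by
  obtain ⟨v, i, rfl⟩ := hβ
  exact ⟨w * v, i, by rw [geomRep_mul_apply]⟩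

theorem neg_mem_roots {β : I → ℝ} (hβ : β ∈ roots cs) : -β ∈ roots cs := by
  obtain ⟨v, i, rfl⟩ := hβ
  exact ⟨v * cs.simple i, i, by rw [geomRep_mul_apply, geomRep_simple_self, map_neg]⟩

theorem form_self_of_mem_roots {β : I → ℝ} (hβ : β ∈ roots cs) : form M β β = 1 := by
  obtain ⟨v, i, rfl⟩ := hβ
  rw [form_geomRep, form_simpleRoot_self]

theorem ne_zero_of_mem_roots {β : I → ℝ} (hβ : β ∈ roots cs) : β ≠ 0 := by
  rintro rfl
  simpa using form_self_of_mem_roots cs hβ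

theorem nonneg_or_nonpos_of_mem_roots {β : I → ℝ} (hβ : β ∈ roots cs) : 0 ≤ β ∨ β ≤ 0 := by
  obtain ⟨w, i, rfl⟩ := hβ
  by_cases hi : cs.IsRightDescent w i
  · right
    have h := geomRep_simpleRoot_nonneg cs (cs.isRightDescent_iff_not_isRightDescent_mul.mp hi)
    rw [geomRep_mul_apply, geomRep_simple_self, map_neg] at h
    exact neg_nonneg.mp h
  · exact Or.inl (geomRep_simpleRoot_nonneg cs hi)

/-- A simple reflection makes only one positive root negative: any other positive root has a
positive coordinate that the reflection does not change. -/
theorem geomRep_simple_nonneg {i : I} {β : I → ℝ} (hβ : β ∈ roots cs) (h0 : 0 ≤ β)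
    (hne : β ≠ simpleRoot i) : 0 ≤ geomRep cs (cs.simple i) β := by
  refine (nonneg_or_nonpos_of_mem_roots cs (geomRep_mem_roots cs _ hβ)).resolve_right fun hneg => ?_
  have hz : ∀ a, a ≠ i → β a = 0 := fun a ha =>
    le_antisymm (by simpa [geomRep_simple_apply_of_ne cs ha] using hneg a) (h0 a)
  have hβi : β = β i • simpleRoot i := by
    ext a
    by_cases ha : a = i
    · subst ha; simp [simpleRoot]
    · simp [simpleRoot, ha, hz a ha]
  have h1 := form_self_of_mem_roots cs hβ
  rw [hβi] at h1
  simp only [map_smul, LinearMap.smul_apply, form_simpleRoot_self, smul_eq_mul] at h1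
  have h0i : 0 ≤ β i := h0 i
  have hi : β i = 1 := by nlinarith
  exact hne (by rw [hβi, hi, one_smul])

/-- A finite Coxeter group has no nonzero fixed vector: averaging over the group is `0` on each
simple root `α i`, as `s i` negates it. -/
theorem eq_zero_of_forall_geomRep_simple_eq [Finite W] {v : I → ℝ}
    (h : ∀ i, geomRep cs (cs.simple i) v = v) : v = 0 := by
  have := Fintype.ofFinite W
  have hfix (w : W) : geomRep cs w v = v := by
    induction w using cs.simple_induction_left with
    | one => simp
    | mul_simple_left w i ih => rw [geomRep_mul_apply, ih, h]
  have hsum : ∑ w : W, geomRep cs w = 0 := by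
    refine LinearMap.pi_ext' fun i => LinearMap.ext_ring ?_
    have key : ∑ w : W, geomRep cs w (simpleRoot i) = -∑ w : W, geomRep cs w (simpleRoot i) := by
      conv_lhs => rw [← Equiv.sum_comp (Equiv.mulRight (cs.simple i))]
      simp [geomRep_simple_self]
    simpa [LinearMap.sum_apply, simpleRoot] using self_eq_neg.mp key
  have h0 := LinearMap.congr_fun hsum v
  simp only [LinearMap.sum_apply, hfix, Finset.sum_const, Finset.card_univ, LinearMap.zero_apply]
    at h0
  exact (smul_eq_zero.mp h0).resolve_left Fintype.card_ne_zero

end RootSystem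

/-! ### Cyclic enumerations of the index set -/

section Enumeration

variable {I : Type*}

/-- `x` runs cyclically through an index set with `n` elements: the first `n` terms list every
element exactly once, and then the list repeats. The letter `x t` is the one used at time `t`. -/
structure IsCyclicEnumeration (x : ℕ → I) (n : ℕ) : Prop where
  pos : 0 < n
  eq_iff : ∀ s t, x s = x t ↔ s ≡ t [MOD n]
  surjective : Function.Surjective x

/-- The first time, from `t` on, at which the letter `a` is used. -/
def nextTime (x : ℕ → I) (t : ℕ) (a : I) : ℕ := sInf {s | t ≤ s ∧ x s = a}

variable {x : ℕ → I} {n : ℕ}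

namespace IsCyclicEnumeration

theorem apply_add (hx : IsCyclicEnumeration x n) (t : ℕ) : x (t + n) = x t :=
  (hx.eq_iff _ _).mpr (by simp [Nat.ModEq])

theorem exists_eq (hx : IsCyclicEnumeration x n) (t : ℕ) (a : I) :
    ∃ s, t ≤ s ∧ s < t + n ∧ x s = a := by
  obtain ⟨r, rfl⟩ := hx.surjective a
  refine ⟨t + (r + n * t - t) % n, by omega, ?_, (hx.eq_iff _ _).mpr ?_⟩
  · have := Nat.mod_lt (r + n * t - t) hx.pos
    omega
  · have h : t ≤ n * t := Nat.le_mul_of_pos_left t hx.pos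
    calc t + (r + n * t - t) % n ≡ t + (r + n * t - t) [MOD n] :=
          Nat.ModEq.add_left _ (Nat.mod_modEq _ _)
      _ = r + n * t := by omega
      _ ≡ r [MOD n] := by simp [Nat.ModEq]

theorem eq_of_lt (hx : IsCyclicEnumeration x n) {s t : ℕ} (hst : s ≤ t) (h : t < s + n)
    (he : x s = x t) : s = t := by
  have h1 := (Nat.modEq_iff_dvd' hst).mp ((hx.eq_iff _ _).mp he)
  have h2 := Nat.eq_zero_of_dvd_of_lt h1 (by omega)
  omega

theorem nextTime_spec (hx : IsCyclicEnumeration x n) (t : ℕ) (a : I) :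
    t ≤ nextTime x t a ∧ x (nextTime x t a) = a := by
  obtain ⟨s, h1, -, h3⟩ := hx.exists_eq t a
  exact Nat.sInf_mem (s := {s | t ≤ s ∧ x s = a}) ⟨s, h1, h3⟩

theorem nextTime_le {s t : ℕ} (h : t ≤ s) : nextTime x t (x s) ≤ s :=
  Nat.sInf_le ⟨h, rfl⟩

theorem nextTime_lt_add (hx : IsCyclicEnumeration x n) (t : ℕ) (a : I) :
    nextTime x t a < t + n := by
  obtain ⟨s, h1, h2, rfl⟩ := hx.exists_eq t a
  exact (nextTime_le h1).trans_lt h2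

theorem nextTime_self (hx : IsCyclicEnumeration x n) (t : ℕ) : nextTime x t (x t) = t :=
  le_antisymm (nextTime_le le_rfl) (hx.nextTime_spec t (x t)).1

theorem lt_nextTime (hx : IsCyclicEnumeration x n) {t : ℕ} {a : I} (h : a ≠ x t) :
    t < nextTime x t a := by
  obtain ⟨h1, h2⟩ := hx.nextTime_spec t a
  refine lt_of_le_of_ne h1 fun he => h ?_
  rw [← h2, ← he]

theorem nextTime_succ_of_ne (hx : IsCyclicEnumeration x n) {t : ℕ} {a : I} (h : a ≠ x t) :
    nextTime x (t + 1) a = nextTime x t a := by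
  refine le_antisymm ?_ ?_
  · have := nextTime_le (x := x) (hx.lt_nextTime h)
    rwa [(hx.nextTime_spec t a).2] at this
  · have := nextTime_le (x := x) ((Nat.le_succ t).trans (hx.nextTime_spec (t + 1) a).1)
    rwa [(hx.nextTime_spec (t + 1) a).2] at this

theorem nextTime_lt_nextTime_succ (hx : IsCyclicEnumeration x n) {t : ℕ} {a : I} (h : a ≠ x t) :
    nextTime x (t + 1) a < nextTime x (t + 1) (x t) := by
  rw [hx.nextTime_succ_of_ne h]
  refine (hx.nextTime_lt_add t a).trans_le ?_
  obtain ⟨h1, h2⟩ := hx.nextTime_spec (t + 1) (x t)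
  by_contra! hlt
  have := hx.eq_of_lt ((Nat.le_succ t).trans h1) hlt h2.symm
  omega

theorem nextTime_injective (hx : IsCyclicEnumeration x n) (t : ℕ) :
    Function.Injective (nextTime x t) := fun a b h => by
  rw [← (hx.nextTime_spec t a).2, h, (hx.nextTime_spec t b).2]

end IsCyclicEnumeration

theorem isCyclicEnumeration_getElem {l : List I} (hl : l.Nodup) (hmem : ∀ i, i ∈ l)
    (hpos : 0 < l.length) :
    IsCyclicEnumeration (fun t => l[t % l.length]'(Nat.mod_lt t hpos)) l.length where
  pos := hpos
  eq_iff s t := hl.getElem_inj_iff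
  surjective a := by
    obtain ⟨k, hk, rfl⟩ := List.mem_iff_getElem.mp (hmem a)
    exact ⟨k, by simp [Nat.mod_eq_of_lt hk]⟩

end Enumeration

section EulerForm

variable {I : Type*} [Fintype I] [DecidableEq I] (M : CoxeterMatrix I)

/-! ### The Euler form -/

/-- The matrix, in the simple roots, of the Euler form at time `t`. -/
def eulerMatrix (x : ℕ → I) (t : ℕ) : Matrix I I ℝ := Matrix.of fun a b =>
  if a = b then 1 else if nextTime x t a < nextTime x t b then 2 * gram M a b else 0

/-- The Euler form `E t` of the Coxeter graph, oriented at time `t` so that `a → b` if the letter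
`a` is due before `b`: the non-symmetric bilinear form with `E + Eᵀ = 2 B` that is unitriangular
with respect to the order in which the letters are due. The letter due first is a source. -/
def eulerForm (x : ℕ → I) (t : ℕ) : LinearMap.BilinForm ℝ (I → ℝ) :=
  Matrix.toBilin' (eulerMatrix M x t)

variable {x : ℕ → I} {n : ℕ}

theorem eulerForm_apply_simpleRoot (hx : IsCyclicEnumeration x n) (t : ℕ) (v : I → ℝ) :
    eulerForm M x t v (simpleRoot (x t)) = v (x t) := by
  have h (a : I) : eulerMatrix M x t a (x t) = if a = x t then 1 else 0 := by
    by_cases ha : a = x t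
    · simp [eulerMatrix, ha]
    · have := (hx.lt_nextTime ha).le
      simp [eulerMatrix, ha, hx.nextTime_self, this]
  simp [eulerForm, Matrix.toBilin'_apply, simpleRoot, Pi.single_apply, h]

theorem eulerForm_add_swap (hx : IsCyclicEnumeration x n) (t : ℕ) (v v' : I → ℝ) :
    eulerForm M x t v v' + eulerForm M x t v' v = 2 * form M v v' := by
  have h (a b : I) : eulerMatrix M x t a b + eulerMatrix M x t b a = 2 * gram M a b := by
    by_cases hab : a = b
    · subst hab
      simp [eulerMatrix, gram_self, one_add_one_eq_two]
    · have hne : nextTime x t a ≠ nextTime x t b := fun h => hab (hx.nextTime_injective t h)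
      rcases lt_or_gt_of_ne hne with hlt | hlt
      · simp [eulerMatrix, hab, Ne.symm hab, hlt, hlt.le]
      · simp [eulerMatrix, hab, Ne.symm hab, hlt, hlt.le, gram_symm M b a]
  simp only [eulerForm, form, Matrix.toBilin'_apply]
  rw [Finset.sum_comm (f := fun a b => v' a * eulerMatrix M x t a b * v b),
    ← Finset.sum_add_distrib, Finset.mul_sum]
  refine Finset.sum_congr rfl fun a _ => ?_
  rw [← Finset.sum_add_distrib, Finset.mul_sum]
  refine Finset.sum_congr rfl fun b _ => ?_
  linear_combination v a * v' b * h a b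

theorem eulerForm_simpleRoot_apply (hx : IsCyclicEnumeration x n) (t : ℕ) (v : I → ℝ) :
    eulerForm M x t (simpleRoot (x t)) v = 2 * form M v (simpleRoot (x t)) - v (x t) := by
  rw [← eulerForm_add_swap M hx, eulerForm_apply_simpleRoot M hx]
  ring

theorem eulerForm_succ (hx : IsCyclicEnumeration x n) (t : ℕ) (v v' : I → ℝ) :
    eulerForm M x (t + 1) v v' = eulerForm M x t v v' + 2 * form M v (simpleRoot (x t)) * v' (x t) -
      2 * v (x t) * form M (simpleRoot (x t)) v' := by
  have h (a b : I) : eulerMatrix M x (t + 1) a b = eulerMatrix M x t a b +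
      2 * gram M a b * (if b = x t then 1 else 0) -
      2 * (if a = x t then 1 else 0) * gram M a b := by
    by_cases hab : a = b
    · subst hab
      simp [eulerMatrix]
    by_cases ha : a = x t
    · have hb : b ≠ x t := fun h => hab (ha.trans h.symm)
      subst ha
      simp [eulerMatrix, hab, hb, hx.nextTime_self, hx.lt_nextTime hb,
        (hx.nextTime_lt_nextTime_succ hb).le]
    · by_cases hb : b = x t
      · subst hb
        simp [eulerMatrix, ha, hx.nextTime_self, (hx.lt_nextTime ha).le,
          hx.nextTime_lt_nextTime_succ ha]
      · simp [eulerMatrix, ha, hb, hx.nextTime_succ_of_ne]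
  simp only [eulerForm, form, Matrix.toBilin'_apply, h]
  simp only [mul_add, add_mul, mul_sub, sub_mul, Finset.sum_add_distrib, Finset.sum_sub_distrib,
    simpleRoot, Pi.single_apply]
  congr 1
  · congr 1
    simp [Finset.mul_sum, Finset.sum_mul]
    exact Finset.sum_congr rfl fun a _ => by ring
  · simp [Finset.mul_sum, mul_assoc]
    exact Finset.sum_congr rfl fun a _ => by ring

/-- Applying the reflection in a source turns the source into a sink. -/
theorem eulerForm_succ_geomRep {W : Type*} [Group W] {M : CoxeterMatrix I}
    (cs : CoxeterSystem M W) (hx : IsCyclicEnumeration x n) (t : ℕ) (v v' : I → ℝ) :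
    eulerForm M x (t + 1) (geomRep cs (cs.simple (x t)) v) (geomRep cs (cs.simple (x t)) v') =
      eulerForm M x t v v' := by
  have h1 : simpleRoot (x t) (x t) = 1 := by simp [simpleRoot]
  simp only [geomRep_simple, eulerForm_succ M hx, map_sub, map_smul, LinearMap.sub_apply,
    LinearMap.smul_apply, smul_eq_mul, eulerForm_apply_simpleRoot M hx,
    eulerForm_simpleRoot_apply M hx, form_simpleRoot_self, h1,
    form_comm (simpleRoot (x t))]
  ring

end EulerForm

/-! ### Products of simple reflections along a cyclic enumeration -/

section Products

variable {I : Type*} {M : CoxeterMatrix I} {W : Type*} [Group W] (cs : CoxeterSystem M W)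
  {x : ℕ → I} {n : ℕ}

/-- The product `s (x (t - 1)) ⋯ s (x 0)`. -/
def prefixProd (x : ℕ → I) : ℕ → W
  | 0 => 1
  | t + 1 => cs.simple (x t) * prefixProd x t

theorem prefixProd_add (hx : IsCyclicEnumeration x n) (t : ℕ) :
    prefixProd cs x (t + n) = prefixProd cs x t * prefixProd cs x n := by
  induction t with
  | zero => simp [prefixProd]
  | succ t ih =>
    rw [Nat.add_right_comm, prefixProd, prefixProd, ih, hx.apply_add, mul_assoc]

theorem prefixProd_mul (hx : IsCyclicEnumeration x n) (k : ℕ) :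
    prefixProd cs x (k * n) = prefixProd cs x n ^ k := by
  induction k with
  | zero => simp [prefixProd]
  | succ k ih => rw [Nat.succ_mul, prefixProd_add cs hx, ih, pow_succ]

end Products

section Dynamics

variable {I : Type*} [Fintype I] [DecidableEq I] {M : CoxeterMatrix I}
  {W : Type*} [Group W] (cs : CoxeterSystem M W)
  {x : ℕ → I} {n : ℕ}

theorem geomRep_prefixProd_succ (t : ℕ) (v : I → ℝ) :
    geomRep cs (prefixProd cs x (t + 1)) v =
      geomRep cs (cs.simple (x t)) (geomRep cs (prefixProd cs x t) v) := by
  rw [prefixProd, geomRep_mul_apply]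

/-- A vector fixed by a Coxeter element is fixed by each simple reflection, as every coordinate can
change only once in the course of one period. -/
theorem geomRep_simple_eq_of_prefixProd_eq (hx : IsCyclicEnumeration x n) {v : I → ℝ}
    (hv : geomRep cs (prefixProd cs x n) v = v) (i : I) : geomRep cs (cs.simple i) v = v := by
  have hcoord (a : I) {s t : ℕ} (hst : s ≤ t) (h : ∀ r, s ≤ r → r < t → x r ≠ a) :
      geomRep cs (prefixProd cs x t) v a = geomRep cs (prefixProd cs x s) v a := by
    induction t, hst using Nat.le_induction with
    | base => rfl
    | succ t hst ih =>
      rw [geomRep_prefixProd_succ,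
        geomRep_simple_apply_of_ne cs (h t hst (Nat.lt_succ_self t)).symm,
        ih fun r h1 h2 => h r h1 (h2.trans (Nat.lt_succ_self t))]
  have hstep (t : ℕ) (ht : t < n) :
      geomRep cs (prefixProd cs x (t + 1)) v = geomRep cs (prefixProd cs x t) v := by
    ext a
    by_cases ha : a = x t
    · subst ha
      have h1 := hcoord (x t) (Nat.succ_le_of_lt ht) fun r h1 h2 he => by
        have := hx.eq_of_lt (s := t) (t := r) (by omega) (by omega) he.symm
        omega
      have h2 := hcoord (x t) (Nat.zero_le t) fun r _ h2 he => by
        have := hx.eq_of_lt (s := r) (t := t) h2.le (by omega) he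
        omega
      rw [← h1, h2, hv, prefixProd, map_one, Module.End.one_apply]
    · rw [geomRep_prefixProd_succ, geomRep_simple_apply_of_ne cs ha]
  have hconst (t : ℕ) (ht : t ≤ n) : geomRep cs (prefixProd cs x t) v = v := by
    induction t with
    | zero => simp [prefixProd]
    | succ t ih => rw [hstep t ht, ih (Nat.le_of_succ_le ht)]
  obtain ⟨t, -, ht, rfl⟩ := hx.exists_eq 0 i
  have h := hconst (t + 1) (by omega)
  rwa [geomRep_prefixProd_succ, hconst t (by omega)] at h

/-- Backwards from time `T`, the orbit of `-α (x T)` under the simple reflections becomes positive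
at some time `t ≥ 0`, and just then it equals the simple root `α (x t)`. It cannot stay negative for
`|W|` periods, since the sum over these is fixed by a Coxeter element and so vanishes. -/
theorem exists_root_orbit [Finite W] (hx : IsCyclicEnumeration x n) {T : ℕ}
    (hT : Nat.card W * n ≤ T) :
    ∃ (ξ : I → ℝ) (t : ℕ), t < T ∧ geomRep cs (prefixProd cs x T) ξ = -simpleRoot (x T) ∧
      geomRep cs (prefixProd cs x t) ξ = simpleRoot (x t) ∧
      ∀ s, t < s → s ≤ T → geomRep cs (prefixProd cs x s) ξ ≤ 0 := by
  classical
  set ξ := geomRep cs (prefixProd cs x T)⁻¹ (-simpleRoot (x T)) with hξ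
  have hroot (w : W) : geomRep cs w ξ ∈ roots cs :=
    geomRep_mem_roots cs _ (geomRep_mem_roots cs _ (neg_mem_roots cs (simpleRoot_mem_roots cs _)))
  have hend : geomRep cs (prefixProd cs x T) ξ = -simpleRoot (x T) := by
    rw [hξ, ← geomRep_mul_apply, mul_inv_cancel, map_one, Module.End.one_apply]
  have hex : ∃ s, s < T ∧ ¬geomRep cs (prefixProd cs x s) ξ ≤ 0 := by
    by_contra! hcon
    set c := prefixProd cs x n with hc
    have hneg (k : ℕ) (hk : k ∈ Finset.range (Nat.card W)) : geomRep cs (c ^ k) ξ ≤ 0 := by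
      rw [Finset.mem_range] at hk
      rw [← prefixProd_mul cs hx]
      exact hcon _ ((Nat.mul_lt_mul_of_pos_right hk hx.pos).trans_le hT)
    have hfix : geomRep cs c (∑ k ∈ Finset.range (Nat.card W), geomRep cs (c ^ k) ξ) =
        ∑ k ∈ Finset.range (Nat.card W), geomRep cs (c ^ k) ξ := by
      rw [map_sum]
      simp only [← geomRep_mul_apply, ← pow_succ']
      have h1 := Finset.sum_range_succ (fun k => geomRep cs (c ^ k) ξ) (Nat.card W)
      rw [Finset.sum_range_succ', pow_card_eq_one', pow_zero] at h1
      exact add_right_cancel h1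
    have hzero := eq_zero_of_forall_geomRep_simple_eq cs
      (geomRep_simple_eq_of_prefixProd_eq cs hx hfix)
    have h0 := (Finset.sum_eq_zero_iff_of_nonpos hneg).mp hzero 0
      (Finset.mem_range.mpr Nat.card_pos)
    exact ne_zero_of_mem_roots cs (hroot _) h0
  obtain ⟨s₀, hs₀, hs₀'⟩ := hex
  let Q : ℕ → Prop := fun s => ¬geomRep cs (prefixProd cs x s) ξ ≤ 0
  set t := Nat.findGreatest Q T with ht
  have hQt : ¬geomRep cs (prefixProd cs x t) ξ ≤ 0 := Nat.findGreatest_spec (P := Q) hs₀.le hs₀'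
  have hneg (s : ℕ) (h1 : t < s) (h2 : s ≤ T) : geomRep cs (prefixProd cs x s) ξ ≤ 0 :=
    not_not.mp (Nat.findGreatest_is_greatest (P := Q) h1 h2)
  have htT : t < T := by
    refine lt_of_le_of_ne (Nat.findGreatest_le T) fun he => hQt ?_
    rw [he, hend]
    exact neg_nonpos.mpr (simpleRoot_nonneg _)
  refine ⟨ξ, t, htT, hend, ?_, hneg⟩
  by_contra hne
  have hpos := (nonneg_or_nonpos_of_mem_roots cs (hroot _)).resolve_right hQt
  have h1 := geomRep_simple_nonneg cs (hroot _) hpos hne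
  rw [← geomRep_prefixProd_succ] at h1
  exact ne_zero_of_mem_roots cs (hroot _)
    (le_antisymm (hneg (t + 1) (Nat.lt_succ_self t) htT) h1)

/-! ### Toggles and the roots that separate an element from a convex set -/

variable {L : Set W}

theorem neg_notMem_rootsOf (hL : L.Nonempty) {β : I → ℝ} (hβ : β ∈ rootsOf cs L) :
    -β ∉ rootsOf cs L := fun h => by
  obtain ⟨w, hw⟩ := hL
  have h1 : 0 ≤ geomRep cs w β := (hβ.2 hw).2
  have h2 : 0 ≤ geomRep cs w (-β) := (h.2 hw).2
  rw [map_neg, neg_nonneg] at h2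
  exact ne_zero_of_mem_roots cs (geomRep_mem_roots cs w hβ.1) (le_antisymm h2 h1)

theorem add_smul_mem_rootsOf {β γ : I → ℝ} (hβ : β ∈ rootsOf cs L) (hγ : γ ∈ rootsOf cs L) {r : ℝ}
    (hr : 0 ≤ r) (h : β + r • γ ∈ roots cs) : β + r • γ ∈ rootsOf cs L := by
  refine ⟨h, fun w hw => ⟨geomRep_mem_roots cs w h, ?_⟩⟩
  have h1 : 0 ≤ geomRep cs w β := (hβ.2 hw).2
  have h2 : 0 ≤ geomRep cs w γ := (hγ.2 hw).2
  change 0 ≤ geomRep cs w (β + r • γ)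
  rw [map_add, map_smul]
  exact add_nonneg h1 (smul_nonneg hr h2)

theorem geomRep_toggle_nonneg {i : I} {u : W} {β : I → ℝ} (hβ : β ∈ rootsOf cs L)
    (h : 0 ≤ geomRep cs u β) : 0 ≤ geomRep cs (toggle cs L i u) β := by
  rw [toggle]
  split_ifs with hi
  · exact h
  · rw [geomRep_mul_apply]
    refine geomRep_simple_nonneg cs (geomRep_mem_roots cs u hβ.1) h fun he => hi ?_
    rwa [← he, ← geomRep_mul_apply, inv_mul_cancel, map_one, Module.End.one_apply]

theorem geomRep_nonpos_of_toggle {i : I} {u : W} {β : I → ℝ} (hβ : β ∈ rootsOf cs L)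
    (h : geomRep cs (toggle cs L i u) β ≤ 0) : geomRep cs u β ≤ 0 := by
  refine (nonneg_or_nonpos_of_mem_roots cs (geomRep_mem_roots cs u hβ.1)).resolve_left fun h' => ?_
  exact ne_zero_of_mem_roots cs (geomRep_mem_roots cs _ hβ.1)
    (le_antisymm h (geomRep_toggle_nonneg cs hβ h'))

/-- The sign condition on the roots `u β` that separate `u` from `L` propagates along a toggle,
with the functional `E t (·, η)` always moving by the reflection. If the toggle crosses a wall, the
roots `u β` move along with the functional. If it does not, then the reflected functional takes on
`u β` the value of the old one on `s (u β)`; depending on the sign of `B (u β, α)`, this value is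
at most the old one on `u β`, or else `s (u β)` itself comes from a separating root. -/
theorem eulerForm_toggle_nonpos (hL : L.Nonempty) (hx : IsCyclicEnumeration x n) {t : ℕ} {u : W}
    {η : I → ℝ} (hη : geomRep cs (cs.simple (x t)) η (x t) ≤ 0)
    (h : ∀ β ∈ rootsOf cs L, geomRep cs u β ≤ 0 → eulerForm M x t (geomRep cs u β) η ≤ 0)
    {β : I → ℝ} (hβ : β ∈ rootsOf cs L) (hneg : geomRep cs (toggle cs L (x t) u) β ≤ 0) :
    eulerForm M x (t + 1) (geomRep cs (toggle cs L (x t) u) β)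
      (geomRep cs (cs.simple (x t)) η) ≤ 0 := by
  have hneg' := geomRep_nonpos_of_toggle cs hβ hneg
  rw [toggle]
  split_ifs with hγ
  · set γ := geomRep cs u⁻¹ (simpleRoot (x t)) with hγdef
    have huγ : geomRep cs u γ = simpleRoot (x t) := by
      rw [hγdef, ← geomRep_mul_apply, mul_inv_cancel, map_one, Module.End.one_apply]
    have hne : -geomRep cs u β ≠ simpleRoot (x t) := fun he => by
      refine neg_notMem_rootsOf cs hL hβ ?_
      rwa [hγdef, ← he, ← map_neg, ← geomRep_mul_apply, inv_mul_cancel, map_one,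
        Module.End.one_apply] at hγ
    rw [← geomRep_simple_simple cs (x t) (geomRep cs u β), eulerForm_succ_geomRep cs hx]
    rcases le_or_gt 0 (2 * form M (geomRep cs u β) (simpleRoot (x t))) with hp | hp
    · have h1 := h β hβ hneg'
      have h2 : 0 ≤ eulerForm M x t (simpleRoot (x t)) η := by
        rw [eulerForm_simpleRoot_apply M hx]
        simpa [geomRep_simple, simpleRoot] using hη
      rw [geomRep_simple, map_sub, map_smul, LinearMap.sub_apply, LinearMap.smul_apply,
        smul_eq_mul]
      nlinarith [mul_nonneg hp h2]
    · have hu : geomRep cs u (β + (-(2 * form M (geomRep cs u β) (simpleRoot (x t)))) • γ) =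
          geomRep cs (cs.simple (x t)) (geomRep cs u β) := by
        rw [map_add, map_smul, huγ, geomRep_simple]
        module
      have hroot : β + (-(2 * form M (geomRep cs u β) (simpleRoot (x t)))) • γ ∈ roots cs := by
        have := geomRep_mem_roots cs (u⁻¹ * cs.simple (x t)) (geomRep_mem_roots cs u hβ.1)
        rwa [geomRep_mul_apply, ← hu, ← geomRep_mul_apply, inv_mul_cancel, map_one,
          Module.End.one_apply] at this
      have hmem := add_smul_mem_rootsOf cs hβ hγ (by linarith) hroot
      rw [← hu]
      refine h _ hmem ?_
      rw [hu, ← neg_nonneg, ← map_neg]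
      exact geomRep_simple_nonneg cs (neg_mem_roots cs (geomRep_mem_roots cs u hβ.1))
        (neg_nonneg.mpr hneg') hne
  · rw [geomRep_mul_apply, eulerForm_succ_geomRep cs hx]
    exact h β hβ hneg'

/-- The orbit of `u` under the toggles at `x 0`, `x 1`, and so on. -/
def toggleSeq (L : Set W) (x : ℕ → I) (u : W) : ℕ → W
  | 0 => u
  | t + 1 => toggle cs L (x t) (toggleSeq L x u t)

theorem toggleSeq_add (hx : IsCyclicEnumeration x n) (u : W) (t : ℕ) :
    toggleSeq cs L x u (t + n) = toggleSeq cs L x (toggleSeq cs L x u n) t := by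
  induction t with
  | zero => simp [toggleSeq]
  | succ t ih => rw [Nat.add_right_comm, toggleSeq, toggleSeq, ih, hx.apply_add]

theorem toggleSeq_mul (hx : IsCyclicEnumeration x n) (u : W) (k : ℕ) :
    toggleSeq cs L x u (k * n) = (fun u => toggleSeq cs L x u n)^[k] u := by
  induction k generalizing u with
  | zero => simp [toggleSeq]
  | succ k ih => rw [Nat.succ_mul, toggleSeq_add cs hx, ih, Function.iterate_succ_apply]

theorem geomRep_toggleSeq_nonpos_of_le {u : W} {β : I → ℝ} (hβ : β ∈ rootsOf cs L) {s t : ℕ}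
    (hst : s ≤ t) (h : geomRep cs (toggleSeq cs L x u t) β ≤ 0) :
    geomRep cs (toggleSeq cs L x u s) β ≤ 0 := by
  induction t, hst using Nat.le_induction with
  | base => exact h
  | succ t _ ih => exact ih (geomRep_nonpos_of_toggle cs hβ h)

theorem geomRep_toggle_apply_of_ne {i a : I} (h : a ≠ i) (u : W) (β : I → ℝ) :
    geomRep cs (toggle cs L i u) β a = geomRep cs u β a := by
  rw [toggle]
  split_ifs
  · rfl
  · rw [geomRep_mul_apply, geomRep_simple_apply_of_ne cs h]

/-- Once `|W|` periods have passed, a root `u β` that separates `u` from `L` has no component along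
the simple root that is due. The orbit of `exists_root_orbit` provides functionals `E s (·, η s)`
that carry the coordinate at `α (x t)` to minus the coordinate at `α (x T)`. The value
`E s (α (x s), η s)` is minus a coordinate of the negative root `η (s + 1)`, which is the sign
condition of `eulerForm_toggle_nonpos`. Hence the last coordinate is both nonpositive and
nonnegative. -/
theorem geomRep_toggleSeq_apply_eq_zero [Finite W] (hL : L.Nonempty)
    (hx : IsCyclicEnumeration x n) {T : ℕ} (hT : Nat.card W * n ≤ T) {u : W} {β : I → ℝ}
    (hβ : β ∈ rootsOf cs L) (hneg : geomRep cs (toggleSeq cs L x u T) β ≤ 0) :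
    geomRep cs (toggleSeq cs L x u T) β (x T) = 0 := by
  obtain ⟨ξ, t, htT, hend, hstart, hξ⟩ := exists_root_orbit cs hx hT
  have key (s : ℕ) (hts : t ≤ s) (hsT : s ≤ T) : ∀ β ∈ rootsOf cs L,
      geomRep cs (toggleSeq cs L x u s) β ≤ 0 → eulerForm M x s
        (geomRep cs (toggleSeq cs L x u s) β) (geomRep cs (prefixProd cs x s) ξ) ≤ 0 := by
    induction s, hts using Nat.le_induction with
    | base =>
      intro β _ h
      rw [hstart, eulerForm_apply_simpleRoot M hx]
      exact h (x t)
    | succ s hts ih =>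
      intro β hβ h
      rw [geomRep_prefixProd_succ]
      refine eulerForm_toggle_nonpos cs hL hx ?_ (ih (by omega)) hβ h
      rw [← geomRep_prefixProd_succ]
      exact hξ (s + 1) (by omega) hsT (x s)
  have h := key T htT.le le_rfl β hβ hneg
  rw [hend, map_neg, eulerForm_apply_simpleRoot M hx, neg_nonpos] at h
  exact le_antisymm (hneg (x T)) h

/-- Since a coordinate of `u β` changes only when its letter is used, a root that separates the orbit
from `L` after `|W| + 1` periods would have all its coordinates equal to `0` one period before. -/
theorem toggleSeq_mem_hull [Finite W] (hL : L.Nonempty) (hx : IsCyclicEnumeration x n) (u : W) :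
    toggleSeq cs L x u ((Nat.card W + 1) * n) ∈ hull cs L := by
  refine Set.mem_iInter₂.mpr fun β hβ => ⟨geomRep_mem_roots cs _ hβ.1, ?_⟩
  refine (nonneg_or_nonpos_of_mem_roots cs
    (geomRep_mem_roots cs _ hβ.1)).resolve_right fun hneg => ?_
  rw [Nat.succ_mul] at hneg
  set T := Nat.card W * n
  refine ne_zero_of_mem_roots cs (geomRep_mem_roots cs (toggleSeq cs L x u T) hβ.1) ?_
  ext a
  have hcoord (s : ℕ) (hs : T ≤ s) (h : s ≤ nextTime x T a) :
      geomRep cs (toggleSeq cs L x u s) β a = geomRep cs (toggleSeq cs L x u T) β a := by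
    induction s, hs using Nat.le_induction with
    | base => rfl
    | succ s hs ih =>
      rw [toggleSeq, geomRep_toggle_apply_of_ne cs ?_, ih (by omega)]
      rintro rfl
      have := IsCyclicEnumeration.nextTime_le (x := x) hs
      omega
  obtain ⟨h1, h2⟩ := hx.nextTime_spec T a
  have h0 := geomRep_toggleSeq_apply_eq_zero cs hL hx h1 hβ
    (geomRep_toggleSeq_nonpos_of_le cs hβ (hx.nextTime_lt_add T a).le hneg)
  rw [h2, hcoord _ h1 le_rfl] at h0
  exact h0

theorem toggleSeq_length_eq_toggleWord (u : W) (ω : List I)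
    (h : ∀ t (ht : t < ω.reverse.length), x t = ω.reverse[t]) :
    toggleSeq cs L x u ω.length = toggleWord cs L ω u := by
  induction ω with
  | nil => rfl
  | cons i ω ih =>
    rw [List.length_cons, toggleSeq, ih, h ω.length (by simp)]
    · simp [toggleWord]
    · intro t ht
      rw [h t (by rw [List.length_reverse] at ht ⊢; simp; omega)]
      simp only [List.reverse_cons]
      rw [List.getElem_append_left]

end Dynamics

end BenderKnuth

end

/-- Every finite Coxeter group is superfuturistic. -/
theorem theorem1p9 {I : Type*} [Fintype I] [DecidableEq I] {M : CoxeterMatrix I}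
    {W : Type*} [Group W] [Finite W] (cs : CoxeterSystem M W) :
    BenderKnuth.IsSuperfuturistic cs := by
  rintro c - L hL hconv ω ⟨hnodup, hmem, -⟩ u
  have hhull : BenderKnuth.hull cs L = L := Eq.symm hconv
  rcases isEmpty_or_nonempty I with hI | ⟨⟨i⟩⟩
  · -- Without simple roots there are no roots, and the hull is all of `W`.
    refine ⟨0, ?_⟩
    rw [← hhull]
    exact Set.mem_iInter₂.mpr fun β hβ => hβ.1.elim fun _ ⟨i, _⟩ => hI.elim i
  · have hpos : 0 < ω.reverse.length := List.length_pos_of_mem (List.mem_reverse.mpr (hmem i))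
    set x : ℕ → I := fun t => ω.reverse[t % ω.reverse.length]'(Nat.mod_lt t hpos) with hxdef
    have hx : BenderKnuth.IsCyclicEnumeration x ω.reverse.length :=
      BenderKnuth.isCyclicEnumeration_getElem (List.nodup_reverse.mpr hnodup)
        (fun i => List.mem_reverse.mpr (hmem i)) hpos
    have heq : (fun u => BenderKnuth.toggleSeq cs L x u ω.reverse.length) =
        BenderKnuth.toggleWord cs L ω := by
      ext u
      rw [List.length_reverse]
      refine BenderKnuth.toggleSeq_length_eq_toggleWord cs (L := L) u ω fun t ht => ?_
      simp only [hxdef, Nat.mod_eq_of_lt ht]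
    have hend := BenderKnuth.toggleSeq_mem_hull cs hL hx u
    rw [BenderKnuth.toggleSeq_mul cs hx, heq, hhull] at hend
    exact ⟨Nat.card W + 1, hend⟩
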